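/- Let $n,k,s$ be nonnegative integers with $k\le s$. Let $I_{n,k,s}\subseteq\mathbb{Q}[x_1,\dots,x_n]$ be the ideal generated by $x_1^s,\dots,x_n^s$ and the elementary symmetric polynomials $e_d(x_1,\dots,x_n)$ for $n-k<d\le n$ (where $e_0=1$ and $e_d=0$ for $d<0$), and let $R_{n,k,s}=\mathbb{Q}[x_1,\dots,x_n]/I_{n,k,s}$. An $(n,k,s)$-staircase is a shuffle (an interleaving preserving the relative order within each sequence) of the integer sequences $(s-1,s-1,\dots,s-1)$, with $n-k$ entries, and $(k-1,k-2,\dots,1,0)$; there are no $(n,k,s)$-staircases if $k>n$. A sequence $(c_1,\dots,c_n)$ of nonnegative integers is $(n,k,s)$-substaircase if it is componentwise $\le$ at least one $(n,k,s)$-staircase. Then the set of monomials $x_1^{c_1}\cdots x_n^{c_n}$, with $(c_1,\dots,c_n)$ an $(n,k,s)$-substaircase sequence, descends to a $\mathbb{Q}$-vector space basis of $R_{n,k,s}$; that is, the images in $R_{n,k,s}$ of the monomials indexed by distinct such sequences are linearly independent over $\mathbb{Q}$ and span $R_{n,k,s}$. -/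

import Mathlib

open MvPolynomial

/-- `c` is a shuffle of `a` and `b`: an interleaving of the two sequences, placed at the
positions `f` and `g` (disjoint, covering all positions), preserving the relative order
of the entries of `a` and of the entries of `b`. -/
def IsShuffle {α : Type*} {p q n : ℕ} (a : Fin p → α) (b : Fin q → α) (c : Fin n → α) : Prop :=
  ∃ (f : Fin p ↪o Fin n) (g : Fin q ↪o Fin n),
    IsCompl (Set.range f) (Set.range g) ∧ (∀ i, c (f i) = a i) ∧ (∀ j, c (g j) = b j)

/-- `b` is an `(n,k,s)`-staircase: a shuffle of `(s-1, …, s-1)`, with `n - k` entries, and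
`(k-1, …, 1, 0)`. The entries are integers, so that `s - 1` is `-1` for `s = 0`.
There is none if `k > n`. -/
def IsStaircase (n k s : ℕ) (b : Fin n → ℤ) : Prop :=
  ∃ r : ℕ, k + r = n ∧
    IsShuffle (fun _ : Fin r => (s : ℤ) - 1) (fun j : Fin k => (k : ℤ) - 1 - ((j : ℕ) : ℤ)) b

/-- A sequence of nonnegative integers is `(n,k,s)`-substaircase if it is componentwise `≤`
at least one `(n,k,s)`-staircase. -/
def IsSubstaircase (n k s : ℕ) (c : Fin n → ℕ) : Prop :=
  ∃ b : Fin n → ℤ, IsStaircase n k s b ∧ ∀ i, (c i : ℤ) ≤ b i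

/-- The ideal `I_{n,k,s}` of `ℚ[x_1, …, x_n]` generated by `x_1^s, …, x_n^s` and the
elementary symmetric polynomials `e_d` with `n - k < d ≤ n`. -/
noncomputable def idealI (n k s : ℕ) : Ideal (MvPolynomial (Fin n) ℚ) :=
  Ideal.span ({p | ∃ i : Fin n, p = X i ^ s} ∪
    {p | ∃ d : ℕ, n < d + k ∧ d ≤ n ∧ p = esymm (Fin n) ℚ d})

/-- The quotient ring `R_{n,k,s} = ℚ[x_1, …, x_n] / I_{n,k,s}`. -/
abbrev RingR (n k s : ℕ) : Type := MvPolynomial (Fin n) ℚ ⧸ idealI n k s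

/-- The image in `R_{n,k,s}` of the monomial `x_1^{c_1} ⋯ x_n^{c_n}`. -/
noncomputable def monomialClass (n k s : ℕ) (c : Fin n → ℕ) : RingR n k s :=
  Ideal.Quotient.mk (idealI n k s) (∏ i : Fin n, X i ^ c i)

/-! The ideal is deformed to one with distinct roots. Given roots `a_j`, `j < s`, and a set `K` of
`k` of the indices, impose `∏_j (x_i - a_j) = 0` for each `i`, and `∏_{j ∈ K} (z - a_j) ∣ ∏_i (z -
x_i)`. With all roots zero these relations generate `idealI` (`idealI_eq_relationIdeal`).

Spanning holds for arbitrary roots over any base ring (`substaircaseSpan_eq_top`). Filter the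
algebra by the ideals generated by the partial products `∏ (x_0 - a)`, roots of `K` first. On each
graded piece `x_0` becomes a root, and the other variables satisfy relations of the same type, with
that root removed from `K` during the first `k` steps. This is the recursion of substaircase
sequences on their first entry.

For distinct roots in a field, the functions on words that use every letter of `K` satisfy the
relations and are generated by the coordinates. Words and substaircase sequences are equinumerous
(`card_words_eq_card_substaircase`), so spanning forces independence.

Finally take the roots `j * t` over `ℚ[t]`. Spanning over `ℚ[t]` lifts a linear relation at `t = 0`
to one over `ℚ[t]`, which is trivial by independence over `ℚ(t)`. -/

/-! ### Substaircase sequences and their recursion on the first entry. -/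

theorem isSubstaircase_iff {n k s : ℕ} (hks : k ≤ s) (c : Fin n → ℕ) :
    IsSubstaircase n k s c ↔
      (∀ i, c i < s) ∧ ∃ g : Fin k → Fin n, StrictMono g ∧ ∀ j, c (g j) + (j : ℕ) < k := by
  constructor
  · rintro ⟨b, ⟨r, -, f, g, hfg, hf, hg⟩, hb⟩
    refine ⟨fun i => ?_, g, g.strictMono, fun j => ?_⟩
    · have hi : i ∈ Set.range f ∪ Set.range g := by
        have := hfg.sup_eq_top
        simp only [Set.sup_eq_union, Set.top_eq_univ] at this
        rw [this]; trivial
      have hbi := hb i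
      rcases hi with ⟨j, rfl⟩ | ⟨j, rfl⟩
      · rw [hf] at hbi; dsimp only at hbi; omega
      · rw [hg] at hbi; dsimp only at hbi; have := j.2; omega
    · have := hb (g j)
      rw [hg] at this
      dsimp only at this
      omega
  · rintro ⟨hs, g, hg, hc⟩
    classical
    have hkn : k ≤ n := by simpa using Fintype.card_le_of_injective g hg.injective
    have hcard : (Finset.univ \ Finset.univ.image g).card = n - k := by
      rw [Finset.card_sdiff_of_subset (Finset.subset_univ _),
        Finset.card_image_of_injective _ hg.injective]
      simp
    have hrange : Set.range (Finset.orderEmbOfFin _ hcard) = (Set.range g)ᶜ := by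
      rw [Finset.range_orderEmbOfFin]; ext; simp
    refine ⟨fun i => if h : ∃ j, g j = i then (k : ℤ) - 1 - ((h.choose : Fin k) : ℕ) else s - 1,
      ⟨n - k, by omega, Finset.orderEmbOfFin _ hcard, OrderEmbedding.ofStrictMono g hg,
        ?_, fun i => ?_, fun j => ?_⟩, fun i => ?_⟩
    · rw [hrange]; exact isCompl_compl.symm
    · have : Finset.orderEmbOfFin _ hcard i ∈ (Set.range g)ᶜ := hrange ▸ Set.mem_range_self i
      exact dif_neg this
    · have h : ∃ j', g j' = g j := ⟨j, rfl⟩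
      have h' : h.choose = j := hg.injective h.choose_spec
      exact (dif_pos h).trans
        (congrArg (fun t : Fin k => (k : ℤ) - 1 - ((t : ℕ) : ℤ)) h')
    · dsimp only
      split_ifs with h
      · have h1 := hc h.choose
        rw [h.choose_spec] at h1
        omega
      · have := hs i
        omega

theorem isSubstaircase_zero_iff {k s : ℕ} (hks : k ≤ s) (c : Fin 0 → ℕ) :
    IsSubstaircase 0 k s c ↔ k = 0 := by
  rw [isSubstaircase_iff hks]
  constructor
  · rintro ⟨-, g, -⟩
    by_contra hk
    exact (g ⟨0, Nat.pos_of_ne_zero hk⟩).elim0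
  · rintro rfl
    exact ⟨fun i => i.elim0, fun j => j.elim0, fun j => j.elim0, fun j => j.elim0⟩

theorem IsSubstaircase.mono {n k s : ℕ} {c d : Fin n → ℕ} (h : IsSubstaircase n k s c)
    (hd : ∀ i, d i ≤ c i) : IsSubstaircase n k s d := by
  obtain ⟨b, hb, hc⟩ := h
  exact ⟨b, hb, fun i => le_trans (by exact_mod_cast hd i) (hc i)⟩

theorem IsSubstaircase.cons_of_lt {n k s i : ℕ} {c : Fin n → ℕ} (hks : k + 1 ≤ s)
    (hi : i < k + 1) (h : IsSubstaircase n k s c) :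
    IsSubstaircase (n + 1) (k + 1) s (Fin.cons i c) := by
  obtain ⟨hs, g, hg, hc⟩ := (isSubstaircase_iff (by omega) c).1 h
  refine (isSubstaircase_iff hks _).2 ⟨fun j => ?_, Fin.cons 0 (fun j => (g j).succ), ?_, ?_⟩
  · refine Fin.cases ?_ (fun j => ?_) j
    · simp; omega
    · simpa using hs j
  · intro j l hjl
    induction l using Fin.cases with
    | zero => exact absurd hjl (Fin.not_lt_zero j)
    | succ l =>
      induction j using Fin.cases with
      | zero => simp [Fin.succ_pos]
      | succ j => simpa using hg (Fin.succ_lt_succ_iff.1 hjl)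
  · intro j
    induction j using Fin.cases with
    | zero => simpa using hi
    | succ j => have := hc j; simp; omega

theorem IsSubstaircase.cons {n k s i : ℕ} {c : Fin n → ℕ} (hks : k ≤ s)
    (hi : i < s) (h : IsSubstaircase n k s c) :
    IsSubstaircase (n + 1) k s (Fin.cons i c) := by
  obtain ⟨hs, g, hg, hc⟩ := (isSubstaircase_iff (by omega) c).1 h
  refine (isSubstaircase_iff hks _).2 ⟨fun j => ?_, fun j => (g j).succ,
    fun j l hjl => Fin.succ_lt_succ_iff.2 (hg hjl), fun j => by simpa using hc j⟩
  refine Fin.cases ?_ (fun j => ?_) j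
  · simpa using hi
  · simpa using hs j

/-- A greedy choice is optimal: a first entry below `k` can always serve as the top step `k - 1`,
and a larger one can serve as no step. -/
theorem isSubstaircase_cons_iff {n k s i : ℕ} {c : Fin n → ℕ} (hks : k ≤ s) :
    IsSubstaircase (n + 1) k s (Fin.cons i c) ↔
      i < s ∧ IsSubstaircase n (if i < k then k - 1 else k) s c := by
  constructor
  · intro h
    obtain ⟨hs, g, hg, hc⟩ := (isSubstaircase_iff hks _).1 h
    have hs' : ∀ j, c j < s := fun j => by simpa using hs j.succ
    refine ⟨by simpa using hs 0, ?_⟩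
    split_ifs with hik
    · obtain ⟨k, rfl⟩ : ∃ k', k = k' + 1 := ⟨k - 1, by omega⟩
      -- The position `g 0` is discarded whether or not it is the first one; the later steps avoid
      -- position `0` in any case.
      have hpos : ∀ j : Fin k, g j.succ ≠ 0 := fun j =>
        (lt_of_le_of_lt (Fin.zero_le (g 0)) (hg (Fin.succ_pos j))).ne'
      refine (isSubstaircase_iff (by omega) _).2 ⟨hs', fun j => (g j.succ).pred (hpos j),
        fun j l hjl => Fin.pred_lt_pred_iff.2 (hg (Fin.succ_lt_succ_iff.2 hjl)), fun j => ?_⟩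
      have := hc j.succ
      rw [← Fin.succ_pred _ (hpos j), Fin.cons_succ] at this
      simp only [Fin.val_succ] at this
      change c ((g j.succ).pred (hpos j)) + (j : ℕ) < k
      omega
    · have hpos : ∀ j : Fin k, g j ≠ 0 := fun j hj => by
        have := hc j
        rw [hj, Fin.cons_zero] at this
        omega
      refine (isSubstaircase_iff hks _).2 ⟨hs', fun j => (g j).pred (hpos j),
        fun j l hjl => Fin.pred_lt_pred_iff.2 (hg hjl), fun j => ?_⟩
      have := hc j
      rwa [← Fin.succ_pred _ (hpos j), Fin.cons_succ] at this
  · rintro ⟨hi, h⟩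
    split_ifs at h with hik
    · obtain ⟨k, rfl⟩ : ∃ k', k = k' + 1 := ⟨k - 1, by omega⟩
      exact IsSubstaircase.cons_of_lt hks hik h
    · exact h.cons hks hi

theorem finite_isSubstaircase (n k s : ℕ) (hks : k ≤ s) :
    Finite {c : Fin n → ℕ // IsSubstaircase n k s c} := by
  refine Finite.of_injective
    (fun c => fun i => (⟨c.1 i, ((isSubstaircase_iff hks c.1).1 c.2).1 i⟩ : Fin s)) ?_
  intro c d h
  ext i
  simpa using congrArg Fin.val (congrFun h i)

/-! ### Counting substaircase sequences by words. -/

/-- Splitting off the first entry of a substaircase sequence. -/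
noncomputable def substaircaseConsEquiv {n k s : ℕ} (hks : k ≤ s) :
    {c : Fin (n + 1) → ℕ // IsSubstaircase (n + 1) k s c} ≃
      Σ i : Fin s, {c : Fin n → ℕ // IsSubstaircase n (if (i : ℕ) < k then k - 1 else k) s c} where
  toFun c :=
    have h := (isSubstaircase_cons_iff hks).1 ((Fin.cons_self_tail c.1).symm ▸ c.2)
    ⟨⟨c.1 0, h.1⟩, ⟨Fin.tail c.1, h.2⟩⟩
  invFun p := ⟨Fin.cons p.1 p.2.1, (isSubstaircase_cons_iff hks).2 ⟨p.1.2, p.2.2⟩⟩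
  left_inv c := Subtype.ext (Fin.cons_self_tail c.1)
  right_inv _ := rfl

/-- Splitting off the first letter of a word that contains all the letters of `K`. -/
def wordConsEquiv {α : Type*} [DecidableEq α] (n : ℕ) (K : Finset α) :
    {y : Fin (n + 1) → α // ∀ j ∈ K, j ∈ Set.range y} ≃
      Σ i : α, {y : Fin n → α // ∀ j ∈ K.erase i, j ∈ Set.range y} where
  toFun y := ⟨y.1 0, Fin.tail y.1, fun j hj => by
    obtain ⟨hne, hK⟩ := Finset.mem_erase.1 hj
    obtain ⟨l, rfl⟩ := y.2 j hK
    induction l using Fin.cases with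
    | zero => exact absurd rfl hne
    | succ l => exact ⟨l, rfl⟩⟩
  invFun p := ⟨Fin.cons p.1 p.2.1, fun j hj => by
    by_cases h : j = p.1
    · exact ⟨0, by simp [h]⟩
    · obtain ⟨l, hl⟩ := p.2.2 j (Finset.mem_erase.2 ⟨h, hj⟩)
      exact ⟨l.succ, by simpa using hl⟩⟩
  left_inv y := Subtype.ext (Fin.cons_self_tail y.1)
  right_inv _ := rfl

/-- Both sides obey the same recursion: of the `s` possible first entries, exactly `K.card` lower
the remaining requirement by one (`i ∈ K` for words, `i < K.card` for sequences). -/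
theorem card_words_eq_card_substaircase {s : ℕ} (n : ℕ) (K : Finset (Fin s)) :
    Nat.card {y : Fin n → Fin s // ∀ j ∈ K, j ∈ Set.range y} =
      Nat.card {c : Fin n → ℕ // IsSubstaircase n K.card s c} := by
  have hcard (K : Finset (Fin s)) : K.card ≤ s := by simpa using K.card_le_univ
  induction n generalizing K with
  | zero =>
    by_cases hK : K = ∅
    · subst hK
      have : Nonempty {c : Fin 0 → ℕ // IsSubstaircase 0 (∅ : Finset (Fin s)).card s c} :=
        ⟨⟨Fin.elim0, (isSubstaircase_zero_iff (by simp) _).2 rfl⟩⟩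
      have : Nonempty {y : Fin 0 → Fin s // ∀ j ∈ (∅ : Finset (Fin s)), j ∈ Set.range y} :=
        ⟨⟨Fin.elim0, by simp⟩⟩
      rw [Nat.card_of_subsingleton this.some, Nat.card_of_subsingleton (Classical.ofNonempty)]
    · obtain ⟨a, ha⟩ := Finset.nonempty_iff_ne_empty.2 hK
      have : IsEmpty {c : Fin 0 → ℕ // IsSubstaircase 0 K.card s c} :=
        ⟨fun c => by
          have := (isSubstaircase_zero_iff (hcard K) _).1 c.2
          exact hK (Finset.card_eq_zero.1 this)⟩
      have : IsEmpty {y : Fin 0 → Fin s // ∀ j ∈ K, j ∈ Set.range y} :=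
        ⟨fun y => (y.2 a ha).choose.elim0⟩
      rw [Nat.card_of_isEmpty, Nat.card_of_isEmpty]
  | succ n ih =>
    have hfin (i : Fin s) :
        Finite {c : Fin n → ℕ // IsSubstaircase n (if (i : ℕ) < K.card then K.card - 1
          else K.card) s c} :=
      finite_isSubstaircase _ _ _ (by have := hcard K; split_ifs <;> omega)
    rw [Nat.card_congr (wordConsEquiv n K), Nat.card_congr (substaircaseConsEquiv (hcard K)),
      Nat.card_sigma, Nat.card_sigma]
    simp only [ih, Finset.card_erase_eq_ite]
    -- The sum depends on `p` only through the number of `i` that satisfy it.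
    have hswap (p : Fin s → Prop) [DecidablePred p] :
        ∑ i, Nat.card {c : Fin n → ℕ // IsSubstaircase n (if p i then K.card - 1
          else K.card) s c} =
        (Finset.univ.filter p).card * Nat.card {c : Fin n → ℕ // IsSubstaircase n (K.card - 1) s c}
          + (s - (Finset.univ.filter p).card) *
            Nat.card {c : Fin n → ℕ // IsSubstaircase n K.card s c} := by
      have : ∀ i, Nat.card {c : Fin n → ℕ // IsSubstaircase n (if p i then K.card - 1
          else K.card) s c} = if p i then Nat.card {c : Fin n → ℕ // IsSubstaircase n (K.card - 1) s c}
          else Nat.card {c : Fin n → ℕ // IsSubstaircase n K.card s c} := fun i => by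
        split_ifs <;> rfl
      simp only [this, Finset.sum_ite, Finset.sum_const, smul_eq_mul]
      congr 2
      rw [← Finset.compl_filter, Finset.card_compl, Fintype.card_fin]
    rw [hswap, hswap]
    have h1 : (Finset.univ.filter (· ∈ K)) = K := by simp
    have h2 : (Finset.univ.filter (fun i : Fin s => (i : ℕ) < K.card)).card = K.card := by
      rw [Fin.card_filter_val_lt]
      exact min_eq_right (hcard K)
    rw [h1, h2]

/-! ### Relations with prescribed roots. -/

/-- The monic polynomial whose multiset of roots is `S`. -/
noncomputable def rootPoly {B : Type*} [CommRing B] (S : Multiset B) : Polynomial B :=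
  (S.map fun a => Polynomial.X - Polynomial.C a).prod

section RootPoly

variable {B : Type*} [CommRing B]

@[simp] theorem rootPoly_zero : rootPoly (0 : Multiset B) = 1 := by simp [rootPoly]

@[simp] theorem rootPoly_cons (a : B) (S : Multiset B) :
    rootPoly (a ::ₘ S) = (Polynomial.X - Polynomial.C a) * rootPoly S := by simp [rootPoly]

theorem rootPoly_add (S T : Multiset B) : rootPoly (S + T) = rootPoly S * rootPoly T := by
  simp [rootPoly]

theorem rootPoly_monic (S : Multiset B) : (rootPoly S).Monic :=
  Polynomial.monic_multiset_prod_of_monic _ _ fun a _ => Polynomial.monic_X_sub_C a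

theorem rootPoly_map {C : Type*} [CommRing C] (f : B →+* C) (S : Multiset B) :
    (rootPoly S).map f = rootPoly (S.map f) := by
  simp [rootPoly, Polynomial.map_multiset_prod, Multiset.map_map]

theorem rootPoly_natDegree [Nontrivial B] (S : Multiset B) :
    (rootPoly S).natDegree = S.card :=
  Polynomial.natDegree_multiset_prod_X_sub_C_eq_card S

theorem rootPoly_replicate_zero (k : ℕ) :
    rootPoly (Multiset.replicate k (0 : B)) = Polynomial.X ^ k := by
  simp [rootPoly]

end RootPoly

/-- The monomial `x_1^{c_1} ⋯ x_n^{c_n}` in the elements `x_i` of a ring. -/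
def monomialAt {A : Type*} [CommRing A] {n : ℕ} (x : Fin n → A) (c : Fin n → ℕ) : A :=
  ∏ i, x i ^ c i

theorem monomialAt_cons {A : Type*} [CommRing A] {n : ℕ} (x : Fin (n + 1) → A) (i : ℕ)
    (c : Fin n → ℕ) :
    monomialAt x (Fin.cons i c) = x 0 ^ i * monomialAt (fun j => x j.succ) c := by
  simp [monomialAt, Fin.prod_univ_succ]

theorem map_monomialAt {A C F : Type*} [CommRing A] [CommRing C] [FunLike F A C]
    [RingHomClass F A C] (f : F) {n : ℕ} (x : Fin n → A) (c : Fin n → ℕ) :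
    f (monomialAt x c) = monomialAt (fun i => f (x i)) c := by
  simp [monomialAt, map_prod]

/-- The submodule spanned by the substaircase monomials in the elements `x_i`. -/
def substaircaseSpan (B : Type*) {A : Type*} [CommRing B] [CommRing A] [Algebra B A] {n : ℕ}
    (k s : ℕ) (x : Fin n → A) : Submodule B A :=
  Submodule.span B (Set.range fun c : {c : Fin n → ℕ // IsSubstaircase n k s c} =>
    monomialAt x c.1)

/-- The elements `x_i` are roots of `rootPoly S`, and `rootPoly K` divides `∏ i, (z - x_i)`. -/
structure SatisfiesRelations {B A : Type*} [CommRing B] [CommRing A] [Algebra B A] {n : ℕ}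
    (K S : Multiset B) (x : Fin n → A) : Prop where
  aeval_eq_zero : ∀ i, Polynomial.aeval (x i) (rootPoly S) = 0
  dvd : (rootPoly K).map (algebraMap B A) ∣ ∏ i, (Polynomial.X - Polynomial.C (x i))

/-! ### Spanning by filtration along the first variable. -/

section Span

variable {B A : Type*} [CommRing B] [CommRing A] [Algebra B A]

theorem SatisfiesRelations.map {C : Type*} [CommRing C] [Algebra B C] (f : A →ₐ[B] C) {n : ℕ}
    {K S : Multiset B} {x : Fin n → A} (h : SatisfiesRelations K S x) :
    SatisfiesRelations K S (fun i => f (x i)) where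
  aeval_eq_zero i := by rw [Polynomial.aeval_algHom_apply, h.aeval_eq_zero, map_zero]
  dvd := by
    have := Polynomial.map_dvd (f : A →+* C) h.dvd
    simpa [Polynomial.map_map, Polynomial.map_prod, AlgHom.comp_algebraMap] using this

/-- A lower-triangular change of basis in the powers of `x 0`. -/
theorem aeval_mul_monomialAt_mem {n k s : ℕ} (x : Fin (n + 1) → A) (p : Polynomial B) {i : ℕ}
    (hp : p.natDegree ≤ i) {c : Fin n → ℕ} (hc : IsSubstaircase (n + 1) k s (Fin.cons i c)) :
    Polynomial.aeval (x 0) p * monomialAt (fun j => x j.succ) c ∈ substaircaseSpan B k s x := by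
  rw [Polynomial.aeval_eq_sum_range, Finset.sum_mul]
  refine Submodule.sum_mem _ fun j hj => ?_
  rw [smul_mul_assoc, ← monomialAt_cons]
  refine Submodule.smul_mem _ _ (Submodule.subset_span
    ⟨⟨(Fin.cons j c : Fin (n + 1) → ℕ), hc.mono fun l => ?_⟩, rfl⟩)
  refine Fin.cases ?_ (fun l => ?_) l
  · simp only [Fin.cons_zero]
    have := Finset.mem_range.1 hj
    omega
  · simp

theorem adjoin_map_range_eq_top {C : Type*} [CommRing C] [Algebra B C] {n : ℕ} {x : Fin n → A}
    (hx : Algebra.adjoin B (Set.range x) = ⊤) (f : A →ₐ[B] C) (hf : Function.Surjective f) :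
    Algebra.adjoin B (Set.range fun i => f (x i)) = ⊤ := by
  have := congrArg (Subalgebra.map f) hx
  rw [AlgHom.map_adjoin, ← Set.range_comp, Algebra.map_top, (AlgHom.range_eq_top f).2 hf] at this
  exact this

theorem adjoin_succ_eq_top {n : ℕ} {x : Fin (n + 1) → A} {a : B} (h0 : x 0 = algebraMap B A a)
    (hx : Algebra.adjoin B (Set.range x) = ⊤) :
    Algebra.adjoin B (Set.range fun i : Fin n => x i.succ) = ⊤ := by
  rw [eq_top_iff, ← hx]
  refine Algebra.adjoin_le ?_
  rintro _ ⟨i, rfl⟩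
  refine Fin.cases ?_ (fun i => ?_) i
  · rw [h0]; exact Subalgebra.algebraMap_mem _ a
  · exact Algebra.subset_adjoin ⟨i, rfl⟩

/-- The ideal of all `r` with `w * r ∈ (w * y)`. -/
def mulColon (w y : A) : Ideal A :=
  Submodule.comap (LinearMap.mulLeft A w) (Ideal.span {w * y})

theorem mem_mulColon {w y r : A} : r ∈ mulColon w y ↔ ∃ t, w * r = w * y * t := by
  simp only [mulColon, Submodule.mem_comap, LinearMap.mulLeft_apply]
  rw [Ideal.mem_span_singleton, dvd_def]

/-- The step of the filtration of `A` by the ideals generated by `p (x 0)`. -/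
theorem exists_add_aeval_mul {n k s i : ℕ} (hks : k ≤ s) (hi : i < s) (x : Fin (n + 1) → A)
    (p : Polynomial B) (hp : p.natDegree ≤ i) (a : B)
    (hspan : substaircaseSpan B (if i < k then k - 1 else k) s
      (fun j : Fin n => Ideal.Quotient.mk
        (mulColon (Polynomial.aeval (x 0) p) (x 0 - algebraMap B A a)) (x j.succ)) = ⊤) (r : A) :
    ∃ m ∈ substaircaseSpan B k s x, ∃ r' : A, Polynomial.aeval (x 0) p * r =
      m + Polynomial.aeval (x 0) ((Polynomial.X - Polynomial.C a) * p) * r' := by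
  set w := Polynomial.aeval (x 0) p with hw
  -- Multiplication by `w` identifies `A ⧸ I` with the graded piece `(w) / (w * (x 0 - a))`, so a
  -- spanning set of `A ⧸ I` yields one of that piece.
  set I := mulColon w (x 0 - algebraMap B A a) with hI
  have hmap : Submodule.map (Ideal.Quotient.mkₐ B I).toLinearMap
      (substaircaseSpan B (if i < k then k - 1 else k) s fun j : Fin n => x j.succ) = ⊤ := by
    rw [← hspan, substaircaseSpan, substaircaseSpan, Submodule.map_span, ← Set.range_comp]
    congr 2
    funext c
    exact map_monomialAt (Ideal.Quotient.mkₐ B I) _ _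
  have hr : Ideal.Quotient.mkₐ B I r ∈ (⊤ : Submodule B (A ⧸ I)) := trivial
  rw [← hmap] at hr
  obtain ⟨m, hm, hmr⟩ := hr
  have hmI : r - m ∈ I := (Ideal.Quotient.eq).1 hmr.symm
  obtain ⟨t, ht⟩ := mem_mulColon.1 hmI
  refine ⟨w * m, ?_, t, ?_⟩
  · have hle : substaircaseSpan B (if i < k then k - 1 else k) s (fun j : Fin n => x j.succ) ≤
        (substaircaseSpan B k s x).comap (LinearMap.mulLeft B w) := by
      refine Submodule.span_le.2 ?_
      rintro _ ⟨c, rfl⟩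
      exact aeval_mul_monomialAt_mem x p hp ((isSubstaircase_cons_iff hks).2 ⟨hi, c.2⟩)
    exact hle hm
  · have : Polynomial.aeval (x 0) ((Polynomial.X - Polynomial.C a) * p) =
        (x 0 - algebraMap B A a) * w := by simp [hw]
    rw [this]
    linear_combination ht

theorem rootPoly_map_dvd_of_cons {C : Type*} [CommRing C] [Algebra B C] {n : ℕ}
    {x : Fin (n + 1) → C} {a : B} {K : Multiset B} (h0 : x 0 = algebraMap B C a)
    (h : (rootPoly (a ::ₘ K)).map (algebraMap B C) ∣
      ∏ i, (Polynomial.X - Polynomial.C (x i))) :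
    (rootPoly K).map (algebraMap B C) ∣
      ∏ i : Fin n, (Polynomial.X - Polynomial.C (x i.succ)) := by
  obtain ⟨q, hq⟩ := h
  refine ⟨q, (Polynomial.monic_X_sub_C (algebraMap B C a)).isRegular.left ?_⟩
  rw [Fin.prod_univ_succ, h0] at hq
  simpa [mul_assoc] using hq

/-- Modulo `z - x 0`, the constant `Q(x 0)` agrees with `Q(z)`; multiplied by the product over the
remaining variables, the error is a multiple of the full product, hence of `Q`. -/
theorem rootPoly_map_dvd_C_mul {n : ℕ} {x : Fin (n + 1) → A} {K : Multiset B}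
    (h : (rootPoly K).map (algebraMap B A) ∣ ∏ i, (Polynomial.X - Polynomial.C (x i))) :
    (rootPoly K).map (algebraMap B A) ∣ Polynomial.C (Polynomial.aeval (x 0) (rootPoly K)) *
      ∏ i : Fin n, (Polynomial.X - Polynomial.C (x i.succ)) := by
  set Q := (rootPoly K).map (algebraMap B A)
  have h1 : Polynomial.aeval (x 0) (rootPoly K) = Q.eval (x 0) := by
    rw [Polynomial.eval_map_algebraMap]
  obtain ⟨g, hg⟩ := Polynomial.X_sub_C_dvd_sub_C_eval (p := Q) (a := x 0)
  rw [Fin.prod_univ_succ] at h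
  set P := ∏ i : Fin n, (Polynomial.X - Polynomial.C (x i.succ))
  have : Polynomial.C (Polynomial.aeval (x 0) (rootPoly K)) * P =
      Q * P - ((Polynomial.X - Polynomial.C (x 0)) * P) * g := by
    rw [h1]; linear_combination -P * hg
  rw [this]
  exact dvd_sub (dvd_mul_right _ _) (h.mul_right _)

/-- Division by a monic polynomial is linear and commutes with base change, so `w` kills each
coefficient of `P %ₘ Q`, and `f` then kills these coefficients. -/
theorem Polynomial.Monic.map_dvd_map_of_dvd_C_mul {C : Type*} [CommRing C] {Q P : Polynomial A}
    (hQ : Q.Monic) {w : A} (h : Q ∣ Polynomial.C w * P) (f : A →+* C)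
    (hf : ∀ r, w * r = 0 → f r = 0) : Q.map f ∣ P.map f := by
  rw [← Polynomial.modByMonic_eq_zero_iff_dvd (hQ.map f), ← Polynomial.map_modByMonic f hQ]
  rw [← Polynomial.modByMonic_eq_zero_iff_dvd hQ, ← Polynomial.smul_eq_C_mul,
    Polynomial.smul_modByMonic] at h
  ext m
  rw [Polynomial.coeff_map]
  exact hf _ (by simpa using congrArg (fun q => q.coeff m) h)

end Span

/-- The algebra `A` varies in the induction, since the hypothesis is applied to the quotients `A ⧸
I`. -/
theorem substaircaseSpan_eq_top {B : Type*} [CommRing B] (n : ℕ) {A : Type*} [CommRing A]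
    [Algebra B A] (K T : Multiset B) (x : Fin n → A) (hx : Algebra.adjoin B (Set.range x) = ⊤)
    (h : SatisfiesRelations K (K + T) x) :
    substaircaseSpan B K.card (K + T).card x = ⊤ := by
  induction n generalizing A K T with
  | zero =>
    rcases subsingleton_or_nontrivial A with hA | hA
    · exact Subsingleton.elim _ _
    · have hd : (rootPoly K).map (algebraMap B A) ∣ 1 := by simpa using h.dvd
      -- A monic divisor of the empty product is `1`, so `K` is empty and the constants are spanned
      -- by the empty monomial.
      have h1 := ((rootPoly_monic K).map (algebraMap B A)).eq_one_of_isUnit (isUnit_of_dvd_one hd)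
      have hK : K.card = 0 := by
        have := congrArg Polynomial.natDegree h1
        rw [rootPoly_map, rootPoly_natDegree] at this
        simpa using this
      rw [eq_top_iff, ← Algebra.top_toSubmodule, ← hx, Set.range_eq_empty, Algebra.adjoin_empty,
        Algebra.toSubmodule_bot, Submodule.one_eq_span, Submodule.span_le, Set.singleton_subset_iff]
      refine Submodule.subset_span ⟨⟨Fin.elim0, ?_⟩, by simp [monomialAt]⟩
      rw [hK]
      exact (isSubstaircase_zero_iff (Nat.zero_le _) _).2 rfl
  | succ n ih =>
    set Sp := substaircaseSpan B K.card (K + T).card x with hSp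
    -- `L` holds the roots already split off and `a` is the next one; `K'` and `T'` are the data for
    -- the remaining variables on the graded piece.
    have hstep (K' T' L : Multiset B) (a : B) (hKT : K' + T' = K + T)
        (hL : L.card < (K + T).card)
        (hK' : K'.card = if L.card < K.card then K.card - 1 else K.card)
        (hd : ∀ I : Ideal A, I = mulColon (Polynomial.aeval (x 0) (rootPoly L))
            (x 0 - algebraMap B A a) → (rootPoly K').map (algebraMap B (A ⧸ I)) ∣
              ∏ i : Fin n, (Polynomial.X - Polynomial.C (Ideal.Quotient.mk I (x i.succ))))
        (r : A) : ∃ m ∈ Sp, ∃ r', Polynomial.aeval (x 0) (rootPoly L) * r =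
          m + Polynomial.aeval (x 0) (rootPoly (a ::ₘ L)) * r' := by
      have hdeg : (rootPoly L).natDegree ≤ L.card := by
        rcases subsingleton_or_nontrivial B with hB | hB
        · simp [Subsingleton.elim (rootPoly L) 0]
        · exact (rootPoly_natDegree L).le
      rw [rootPoly_cons]
      refine exists_add_aeval_mul (i := L.card) (by simp) hL x (rootPoly L) hdeg a ?_ r
      set I := mulColon (Polynomial.aeval (x 0) (rootPoly L)) (x 0 - algebraMap B A a) with hI
      rw [← hK', ← hKT]
      have h0 : Ideal.Quotient.mkₐ B I (x 0) = algebraMap B (A ⧸ I) a := by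
        refine (Ideal.Quotient.eq (x := x 0) (y := algebraMap B A a)).2 (mem_mulColon.2 ⟨1, ?_⟩)
        ring
      refine ih K' T' (fun j => Ideal.Quotient.mkₐ B I (x j.succ)) ?_ ⟨fun i => ?_, hd I hI⟩
      · exact adjoin_succ_eq_top (x := fun j => Ideal.Quotient.mkₐ B I (x j)) h0
          (adjoin_map_range_eq_top hx _ (Ideal.Quotient.mkₐ_surjective B I))
      · rw [hKT]
        exact (h.map (Ideal.Quotient.mkₐ B I)).aeval_eq_zero i.succ
    have hfirst (L : Multiset B) : ∀ K', L + K' = K → ∀ r, ∃ m ∈ Sp, ∃ r',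
        r = m + Polynomial.aeval (x 0) (rootPoly L) * r' := by
      induction L using Multiset.induction with
      | empty => exact fun K' _ r => ⟨0, Sp.zero_mem, r, by simp⟩
      | cons a L ihL =>
        intro K' hK r
        obtain ⟨m, hm, r', rfl⟩ := ihL (a ::ₘ K') (by rw [← hK]; simp) r
        have hcard : K.card = L.card + K'.card + 1 := by
          rw [← hK]; simp +arith
        -- On this piece `x 0 = a`, so the factor `z - a` cancels from the divisibility. The root
        -- `a` moves from `K` to `T`, because each remaining variable is still annihilated by the
        -- full product.
        obtain ⟨m', hm', t, ht⟩ := hstep (L + K') (a ::ₘ T) L a (by rw [← hK]; simp)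
          (by rw [Multiset.card_add]; omega) (by rw [Multiset.card_add, if_pos (by omega)]; omega)
          (fun I hI => by
            have h0 : Ideal.Quotient.mkₐ B I (x 0) = algebraMap B (A ⧸ I) a := by
              refine (Ideal.Quotient.eq (x := x 0) (y := algebraMap B A a)).2 ?_
              rw [hI]
              exact mem_mulColon.2 ⟨1, by ring⟩
            refine rootPoly_map_dvd_of_cons (x := fun j => Ideal.Quotient.mkₐ B I (x j)) h0 ?_
            rw [← Multiset.cons_add, hK]
            exact (h.map (Ideal.Quotient.mkₐ B I)).dvd) r'
        exact ⟨m + m', Sp.add_mem hm hm', t, by rw [ht]; ring⟩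
    have hsecond (L : Multiset B) : ∀ T', L + T' = T → ∀ r, ∃ m ∈ Sp, ∃ r',
        r = m + Polynomial.aeval (x 0) (rootPoly (K + L)) * r' := by
      induction L using Multiset.induction with
      | empty => intro T' _ r; simpa using hfirst K 0 (by simp) r
      | cons a L ihL =>
        intro T' hT r
        obtain ⟨m, hm, r', rfl⟩ := ihL (a ::ₘ T') (by rw [← hT]; simp) r
        have hcard : T.card = L.card + T'.card + 1 := by
          rw [← hT]; simp +arith
        obtain ⟨m', hm', t, ht⟩ := hstep K T (K + L) a rfl
          (by simp only [Multiset.card_add]; omega)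
          (by rw [Multiset.card_add, if_neg (by omega)])
          (fun I hI => by
            -- All of `K` has been split off: the factor `rootPoly K` evaluated at `x 0` makes the
            -- divisibility by `K` hold without `x 0`, and passing to `A ⧸ I` kills the annihilator
            -- of the whole factor.
            have hd : (rootPoly K).map (algebraMap B A) ∣
                Polynomial.C (Polynomial.aeval (x 0) (rootPoly (K + L))) *
                  ∏ i : Fin n, (Polynomial.X - Polynomial.C (x i.succ)) := by
              rw [rootPoly_add, map_mul, mul_comm (Polynomial.aeval _ _), Polynomial.C_mul,
                mul_assoc]
              exact (rootPoly_map_dvd_C_mul h.dvd).mul_left _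
            have := ((rootPoly_monic K).map (algebraMap B A)).map_dvd_map_of_dvd_C_mul hd
              (Ideal.Quotient.mk I) (fun r hr => Ideal.Quotient.eq_zero_iff_mem.2 (by
                rw [hI]; exact mem_mulColon.2 ⟨0, by rw [hr, mul_zero]⟩))
            rw [Polynomial.map_map, Polynomial.map_prod] at this
            simpa using this) r'
        exact ⟨m + m', Sp.add_mem hm hm', t, by rw [Multiset.add_cons, ht]; ring⟩
    refine eq_top_iff.2 fun r _ => ?_
    obtain ⟨m, hm, r', rfl⟩ := hsecond T 0 (by simp) r
    rw [h.aeval_eq_zero 0, zero_mul, add_zero]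
    exact hm

/-! ### Distinct roots: functions on words. -/

section Words

/-- The coordinate functions on the set of words that contain all the letters of `K`, with the
letters evaluated by `a`. -/
def wordCoord {D : Type*} {s : ℕ} (n : ℕ) (K : Finset (Fin s)) (a : Fin s → D) (i : Fin n) :
    {y : Fin n → Fin s // ∀ j ∈ K, j ∈ Set.range y} → D :=
  fun y => a (y.1 i)

/-- At each word, distinct letters of `K` sit at distinct positions, so the product over `K` is a
subproduct of the one over positions. Divisibility over the ring of functions is checked pointwise
through the remainder. -/
theorem satisfiesRelations_wordCoord {B D : Type*} [CommRing B] [CommRing D] [Algebra B D]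
    {s : ℕ} (n : ℕ) (K : Finset (Fin s)) (a : Fin s → B) :
    SatisfiesRelations (K.val.map a) (Finset.univ.val.map a)
      (wordCoord n K fun j => algebraMap B D (a j)) where
  aeval_eq_zero i := by
    funext y
    have h : Polynomial.aeval (a (y.1 i)) (rootPoly (Finset.univ.val.map a)) = 0 := by
      rw [rootPoly, Multiset.map_map, map_multiset_prod, Multiset.map_map]
      refine Multiset.prod_eq_zero (Multiset.mem_map.2 ⟨y.1 i, Finset.mem_univ_val _, ?_⟩)
      simp
    have h1 := Polynomial.aeval_algHom_apply (Pi.evalAlgHom B (fun _ => D) y)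
      (wordCoord n K (fun j => algebraMap B D (a j)) i) (rootPoly (Finset.univ.val.map a))
    have h2 := Polynomial.aeval_algebraMap_apply D (a (y.1 i)) (rootPoly (Finset.univ.val.map a))
    rw [h, map_zero] at h2
    exact h1.symm.trans h2
  dvd := by
    rw [← Polynomial.modByMonic_eq_zero_iff_dvd ((rootPoly_monic _).map _)]
    ext m y
    have hmap : ((∏ i, (Polynomial.X - Polynomial.C
        (wordCoord n K (fun j => algebraMap B D (a j)) i))) %ₘ
        (rootPoly (K.val.map a)).map (algebraMap B _)).map (Pi.evalRingHom (fun _ => D) y) = 0 := by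
      rw [Polynomial.map_modByMonic _ ((rootPoly_monic _).map _),
        Polynomial.modByMonic_eq_zero_iff_dvd (((rootPoly_monic _).map _).map _),
        Polynomial.map_map, Polynomial.map_prod, rootPoly_map, rootPoly, Multiset.map_map,
        Multiset.map_map]
      choose g hg using y.2
      have hinj : Function.Injective fun j : K => g j.1 j.2 := fun j l hjl => by
        have := congrArg y.1 hjl
        simp only [hg] at this
        exact Subtype.ext this
      have hprod : (Multiset.map ((fun b => Polynomial.X - Polynomial.C b) ∘
          ((Pi.evalRingHom (fun _ => D) y).comp (algebraMap B _)) ∘ a) K.val).prod =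
          ∏ i ∈ Finset.univ.map ⟨_, hinj⟩,
            (Polynomial.X - Polynomial.C (algebraMap B D (a (y.1 i)))) := by
        rw [Finset.prod_map]
        simp only [Function.Embedding.coeFn_mk, hg]
        rw [Finset.prod_coe_sort K fun j => Polynomial.X - Polynomial.C (algebraMap B D (a j))]
        rfl
      refine (hprod.dvd).trans ((Finset.prod_dvd_prod_of_subset _ _ _
        (Finset.subset_univ _)).trans (dvd_of_eq ?_))
      simp [wordCoord]
    simpa using congrArg (fun q => q.coeff m) hmap

/-- Products of Lagrange basis polynomials in the coordinates are the indicator functions of single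
words. -/
theorem adjoin_wordCoord_eq_top {F : Type*} [Field F] {s : ℕ} (n : ℕ) (K : Finset (Fin s))
    {a : Fin s → F} (ha : Function.Injective a) :
    Algebra.adjoin F (Set.range (wordCoord n K a)) = ⊤ := by
  classical
  rw [eq_top_iff]
  rintro f -
  have hf : f = ∑ y, f y • ∏ i, Polynomial.aeval (wordCoord n K a i)
      (Lagrange.basis Finset.univ a (y.1 i)) := by
    funext z
    have hz (y : {y : Fin n → Fin s // ∀ j ∈ K, j ∈ Set.range y}) (i : Fin n) :
        Polynomial.aeval (wordCoord n K a i) (Lagrange.basis Finset.univ a (y.1 i)) z =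
          if z.1 i = y.1 i then 1 else 0 := by
      refine (Polynomial.aeval_algHom_apply (Pi.evalAlgHom F (fun _ => F) z) _ _).symm.trans ?_
      change Polynomial.aeval (a (z.1 i)) _ = _
      rw [Polynomial.coe_aeval_eq_eval]
      split_ifs with h
      · rw [h]
        exact Lagrange.eval_basis_self ha.injOn (Finset.mem_univ _)
      · exact Lagrange.eval_basis_of_ne (Ne.symm h) (Finset.mem_univ _)
    simp only [Finset.sum_apply, Pi.smul_apply, Finset.prod_apply, hz, smul_eq_mul]
    rw [Finset.sum_eq_single z]
    · simp
    · intro y _ hyz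
      obtain ⟨i, hi⟩ := Function.ne_iff.1 fun h => hyz (Subtype.ext h)
      rw [Finset.prod_eq_zero (Finset.mem_univ i) (if_neg (Ne.symm hi)), mul_zero]
    · simp
  rw [hf]
  refine Subalgebra.sum_mem _ fun y _ => Subalgebra.smul_mem _ (Subalgebra.prod_mem _ fun i _ => ?_) _
  exact Algebra.adjoin_mono (Set.singleton_subset_iff.2 (Set.mem_range_self i))
    (Polynomial.aeval_mem_adjoin_singleton F (wordCoord n K a i))

theorem card_add_compl_map {α : Type*} {s : ℕ} (K : Finset (Fin s)) (a : Fin s → α) :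
    K.val.map a + Kᶜ.val.map a = Finset.univ.val.map a := by
  rw [← Multiset.map_add]
  congr 1
  rw [← Finset.disjUnion_val _ _ disjoint_compl_right, Finset.disjUnion_eq_union,
    Finset.union_compl]

theorem linearIndependent_monomialAt_wordCoord {F : Type*} [Field F] {s : ℕ} (n : ℕ)
    (K : Finset (Fin s)) {a : Fin s → F} (ha : Function.Injective a) :
    LinearIndependent F (fun c : {c : Fin n → ℕ // IsSubstaircase n K.card s c} =>
      monomialAt (wordCoord n K a) c.1) := by
  classical
  have hfin := finite_isSubstaircase n K.card s (by simpa using K.card_le_univ)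
  have := Fintype.ofFinite {c : Fin n → ℕ // IsSubstaircase n K.card s c}
  have hspan := substaircaseSpan_eq_top (B := F) n (K.val.map a) (Kᶜ.val.map a) _
    (adjoin_wordCoord_eq_top n K ha)
    (by rw [card_add_compl_map]; exact satisfiesRelations_wordCoord (D := F) n K a)
  rw [card_add_compl_map] at hspan
  simp only [Multiset.card_map, Finset.card_val, Finset.card_univ, Fintype.card_fin] at hspan
  refine linearIndependent_of_top_le_span_of_card_eq_finrank hspan.ge ?_
  rw [Module.finrank_fintype_fun_eq_card, ← Nat.card_eq_fintype_card, ← Nat.card_eq_fintype_card,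
    card_words_eq_card_substaircase]

end Words

/-! ### The universal algebra of the relations. -/

section RelationIdeal

variable {B : Type*} [CommRing B]

/-- The ideal of the relations in `SatisfiesRelations`. -/
noncomputable def relationIdeal (n : ℕ) (K S : Multiset B) : Ideal (MvPolynomial (Fin n) B) :=
  Ideal.span (Set.range (fun i => Polynomial.aeval (X i) (rootPoly S)) ∪
    Set.range fun m => ((∏ i, (Polynomial.X - Polynomial.C (X i))) %ₘ
      (rootPoly K).map (algebraMap B (MvPolynomial (Fin n) B))).coeff m)

theorem satisfiesRelations_mk (n : ℕ) (K S : Multiset B) :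
    SatisfiesRelations K S
      (fun i : Fin n => Ideal.Quotient.mk (relationIdeal n K S) (X i)) where
  aeval_eq_zero i := by
    refine (Polynomial.aeval_algHom_apply (Ideal.Quotient.mkₐ B (relationIdeal n K S))
      (X i) (rootPoly S)).trans ?_
    exact Ideal.Quotient.eq_zero_iff_mem.2 (Ideal.subset_span (Or.inl ⟨i, rfl⟩))
  dvd := by
    have hmap : ((∏ i, (Polynomial.X - Polynomial.C (X i : MvPolynomial (Fin n) B))) %ₘ
        (rootPoly K).map (algebraMap B _)).map (Ideal.Quotient.mk (relationIdeal n K S)) = 0 := by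
      ext m
      rw [Polynomial.coeff_map]
      exact Ideal.Quotient.eq_zero_iff_mem.2 (Ideal.subset_span (Or.inr ⟨m, rfl⟩))
    rw [Polynomial.map_modByMonic _ ((rootPoly_monic _).map _),
      Polynomial.modByMonic_eq_zero_iff_dvd (((rootPoly_monic _).map _).map _),
      Polynomial.map_map, Polynomial.map_prod] at hmap
    simp only [Polynomial.map_sub, Polynomial.map_X, Polynomial.map_C] at hmap
    exact hmap

theorem SatisfiesRelations.relationIdeal_le {A : Type*} [CommRing A] [Algebra B A] {n : ℕ}
    {K S : Multiset B} {x : Fin n → A} (h : SatisfiesRelations K S x) :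
    relationIdeal n K S ≤ RingHom.ker (aeval x : MvPolynomial (Fin n) B →ₐ[B] A) := by
  refine Ideal.span_le.2 ?_
  rintro _ (⟨i, rfl⟩ | ⟨m, rfl⟩)
  · refine (Polynomial.aeval_algHom_apply (aeval x) (X i) (rootPoly S)).symm.trans ?_
    rw [aeval_X, h.aeval_eq_zero]
  · have hmap : ((∏ i, (Polynomial.X - Polynomial.C (X i : MvPolynomial (Fin n) B))) %ₘ
        (rootPoly K).map (algebraMap B _)).map
          ((aeval x : MvPolynomial (Fin n) B →ₐ[B] A) : MvPolynomial (Fin n) B →+* A) = 0 := by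
      rw [Polynomial.map_modByMonic _ ((rootPoly_monic _).map _),
        Polynomial.modByMonic_eq_zero_iff_dvd (((rootPoly_monic _).map _).map _),
        Polynomial.map_map, Polynomial.map_prod, AlgHom.comp_algebraMap]
      simpa using h.dvd
    have := congrArg (fun q => q.coeff m) hmap
    simpa using this

/-- This inclusion allows elements of a specialized ideal to be lifted to the deformed one. -/
theorem relationIdeal_map_le {C : Type*} [CommRing C] (f : B →+* C) (n : ℕ) (K S : Multiset B) :
    relationIdeal n (K.map f) (S.map f) ≤ (relationIdeal n K S).map (map f) := by
  refine Ideal.span_le.2 ?_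
  rintro _ (⟨i, rfl⟩ | ⟨m, rfl⟩)
  · have h : map f (Polynomial.aeval (X i : MvPolynomial (Fin n) B) (rootPoly S)) ∈
        (relationIdeal n K S).map (map f) :=
      Ideal.mem_map_of_mem _ (Ideal.subset_span (Or.inl ⟨i, rfl⟩))
    change Polynomial.aeval (X i) _ ∈ _
    convert! h using 1
    rw [Polynomial.aeval_def, Polynomial.aeval_def, Polynomial.hom_eval₂, ← rootPoly_map,
      Polynomial.eval₂_map, map_X]
    congr 1
    ext; simp [algebraMap_eq]
  · have h := Ideal.mem_map_of_mem (map f) (Ideal.subset_span (Or.inr ⟨m, rfl⟩) :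
      ((∏ i, (Polynomial.X - Polynomial.C (X i : MvPolynomial (Fin n) B))) %ₘ
        (rootPoly K).map (algebraMap B _)).coeff m ∈ relationIdeal n K S)
    change Polynomial.coeff _ m ∈ _
    convert! h using 1
    rw [← Polynomial.coeff_map, Polynomial.map_modByMonic _ ((rootPoly_monic _).map _),
      Polynomial.map_map, Polynomial.map_prod, ← rootPoly_map, Polynomial.map_map]
    have : (map f).comp (algebraMap B (MvPolynomial (Fin n) B)) =
        (algebraMap C (MvPolynomial (Fin n) C)).comp f := by
      ext; simp [algebraMap_eq]
    rw [this]
    simp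

theorem adjoin_mk_X_eq_top (n : ℕ) (J : Ideal (MvPolynomial (Fin n) B)) :
    Algebra.adjoin B (Set.range fun i : Fin n => Ideal.Quotient.mk J (X i)) = ⊤ :=
  adjoin_map_range_eq_top (adjoin_range_X) (Ideal.Quotient.mkₐ B J)
    (Ideal.Quotient.mkₐ_surjective B J)

theorem substaircaseSpan_mk_X_eq_top (n : ℕ) (K T : Multiset B) :
    substaircaseSpan B K.card (K + T).card
      (fun i : Fin n => Ideal.Quotient.mk (relationIdeal n K (K + T)) (X i)) = ⊤ :=
  substaircaseSpan_eq_top n K T _ (adjoin_mk_X_eq_top n _) (satisfiesRelations_mk n K _)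

/-- Evaluating at words over the fraction field kills the ideal and keeps the substaircase monomials
independent. -/
theorem eq_zero_of_sum_mem_relationIdeal [IsDomain B] {s n : ℕ} (K : Finset (Fin s))
    {a : Fin s → B} (ha : Function.Injective a)
    (b : {c : Fin n → ℕ // IsSubstaircase n K.card s c} →₀ B)
    (hb : (b.sum fun c r => r • monomialAt X c.1) ∈
      relationIdeal n (K.val.map a) (Finset.univ.val.map a)) : b = 0 := by
  have h := (satisfiesRelations_wordCoord (D := FractionRing B) n K a).relationIdeal_le hb
  have hli := linearIndependent_monomialAt_wordCoord n K
    (a := fun j => algebraMap B (FractionRing B) (a j))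
    ((IsFractionRing.injective B (FractionRing B)).comp ha)
  rw [RingHom.mem_ker, Finsupp.sum, map_sum] at h
  have hz := linearIndependent_iff'.1 hli b.support
    (fun c => algebraMap B (FractionRing B) (b c)) (by
      rw [← h]
      refine Finset.sum_congr rfl fun c _ => ?_
      rw [map_smul, map_monomialAt, algebraMap_smul]
      simp)
  ext c
  by_contra hc
  exact hc ((map_eq_zero_iff _ (IsFractionRing.injective B (FractionRing B))).1
    (hz c (Finsupp.mem_support_iff.2 hc)))

end RelationIdeal

/-! ### Specialization to zero roots and the lifting argument. -/

theorem coeff_prod_X_sub_C_X {n d : ℕ} (hd : d ≤ n) :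
    (∏ i : Fin n, (Polynomial.X - Polynomial.C (X i : MvPolynomial (Fin n) ℚ))).coeff (n - d) =
      (-1) ^ d * esymm (Fin n) ℚ d := by
  have := Multiset.prod_X_sub_C_coeff
    (Finset.univ.val.map (X : Fin n → MvPolynomial (Fin n) ℚ)) (k := n - d) (by simp)
  rw [Multiset.map_map, ← esymm_eq_multiset_esymm] at this
  simp only [Multiset.card_map, Finset.card_val, Finset.card_univ, Fintype.card_fin,
    Nat.sub_sub_self hd] at this
  exact this

theorem Polynomial.coeff_modByMonic_X_pow {R : Type*} [CommRing R] (p : Polynomial R) (k m : ℕ) :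
    (p %ₘ Polynomial.X ^ k).coeff m = if m < k then p.coeff m else 0 := by
  nontriviality R
  split_ifs with h
  · conv_rhs => rw [← Polynomial.modByMonic_add_div p (Polynomial.X ^ k)]
    rw [Polynomial.coeff_add, Polynomial.coeff_X_pow_mul', if_neg (by omega), add_zero]
  · refine Polynomial.coeff_eq_zero_of_degree_lt
      ((Polynomial.degree_modByMonic_lt p (Polynomial.monic_X_pow k)).trans_le ?_)
    rw [Polynomial.degree_X_pow]
    exact_mod_cast not_lt.1 h

/-- Reduction modulo `z ^ k` keeps the coefficients of degree `m < k`, which are `± e_{n-m}` for `m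
≤ n` and zero for `m > n`. -/
theorem idealI_eq_relationIdeal (n k s : ℕ) :
    idealI n k s = relationIdeal n (Multiset.replicate k 0) (Multiset.replicate s 0) := by
  have hgen (m : ℕ) : ((∏ i, (Polynomial.X - Polynomial.C (X i : MvPolynomial (Fin n) ℚ))) %ₘ
      (rootPoly (Multiset.replicate k 0)).map (algebraMap ℚ _)).coeff m =
      if m < k then (∏ i, (Polynomial.X - Polynomial.C (X i : MvPolynomial (Fin n) ℚ))).coeff m
      else 0 := by
    rw [rootPoly_replicate_zero, Polynomial.map_pow, Polynomial.map_X,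
      Polynomial.coeff_modByMonic_X_pow]
  apply le_antisymm
  · refine Ideal.span_le.2 ?_
    rintro _ (⟨i, rfl⟩ | ⟨d, hd, hdn, rfl⟩)
    · exact Ideal.subset_span (Or.inl ⟨i, by simp [rootPoly_replicate_zero]⟩)
    · have h : ((-1) ^ d * esymm (Fin n) ℚ d) ∈
          relationIdeal n (Multiset.replicate k (0 : ℚ)) (Multiset.replicate s 0) :=
        Ideal.subset_span (Or.inr ⟨n - d, by
          simp only [hgen]
          rw [if_pos (by omega), coeff_prod_X_sub_C_X hdn]⟩)
      have h' := Ideal.mul_mem_left _ ((-1) ^ d) h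
      rwa [← mul_assoc, ← mul_pow, neg_one_mul, neg_neg, one_pow, one_mul] at h'
  · refine Ideal.span_le.2 ?_
    rintro _ (⟨i, rfl⟩ | ⟨m, rfl⟩)
    · exact Ideal.subset_span (Or.inl ⟨i, by simp [rootPoly_replicate_zero]⟩)
    · simp only [hgen]
      split_ifs with hm
      · rcases le_or_gt m n with hmn | hmn
        · have h := coeff_prod_X_sub_C_X (n := n) (d := n - m) (by omega)
          rw [Nat.sub_sub_self hmn] at h
          rw [h]
          exact Ideal.mul_mem_left _ _ (Ideal.subset_span
            (Or.inr ⟨n - m, by omega, by omega, rfl⟩))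
        · rw [Polynomial.coeff_eq_zero_of_natDegree_lt]
          · exact Ideal.zero_mem _
          · rw [Polynomial.natDegree_finsetProd_X_sub_C_eq_card]
            simpa using hmn
      · exact Ideal.zero_mem _

theorem substaircaseSpan_idealI_eq_top {n k s : ℕ} (hks : k ≤ s) :
    substaircaseSpan ℚ k s (fun i : Fin n => Ideal.Quotient.mk (idealI n k s) (X i)) = ⊤ := by
  have h := substaircaseSpan_mk_X_eq_top n (Multiset.replicate k (0 : ℚ))
    (Multiset.replicate (s - k) 0)
  rw [← Multiset.replicate_add, Nat.add_sub_cancel' hks, ← idealI_eq_relationIdeal] at h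
  simpa only [Multiset.card_replicate] using h

theorem sum_add_smul_smul {R M ι : Type*} [CommRing R] [AddCommGroup M] [Module R M]
    (u v : ι →₀ R) (r : R) (m : ι → M) :
    ((u + r • v).sum fun i t => t • m i) =
      (u.sum fun i t => t • m i) + r • v.sum fun i t => t • m i := by
  have := ((Finsupp.linearCombination R m).map_add u (r • v))
  rw [map_smul] at this
  exact this

/-- A linear relation among substaircase monomials modulo `idealI` lifts to the deformation of
`idealI` over `ℚ[t]` whose roots are the multiples `j * t`. -/
theorem eq_zero_of_sum_mem_idealI {n k s : ℕ} (hks : k ≤ s)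
    (b : {c : Fin n → ℕ // IsSubstaircase n k s c} →₀ ℚ)
    (hb : (b.sum fun c r => r • monomialAt X c.1) ∈ idealI n k s) : b = 0 := by
  let a : Fin s → Polynomial ℚ := fun j => Polynomial.C ((j : ℕ) : ℚ) * Polynomial.X
  have ha : Function.Injective a := fun i j hij => by
    have := congrArg (fun p => Polynomial.coeff p 1) hij
    simp only [a, Polynomial.coeff_C_mul, Polynomial.coeff_X_one, mul_one, Nat.cast_inj] at this
    exact Fin.ext this
  obtain ⟨K, hK⟩ : ∃ K : Finset (Fin s), K.card = k := by
    obtain ⟨K, -, hK⟩ := Finset.exists_subset_card_eq (s := (Finset.univ : Finset (Fin s)))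
      (n := k) (by simpa using hks)
    exact ⟨K, hK⟩
  subst hK
  have hrep (L : Finset (Fin s)) : (L.val.map a).map (Polynomial.constantCoeff : _ →+* ℚ) =
      Multiset.replicate L.card 0 := by
    rw [Multiset.map_map]
    refine Multiset.eq_replicate.2 ⟨by simp, fun r hr => ?_⟩
    obtain ⟨j, -, rfl⟩ := Multiset.mem_map.1 hr
    simp [a]
  set J := relationIdeal n (K.val.map a) (Finset.univ.val.map a) with hJ
  have hspan := substaircaseSpan_mk_X_eq_top n (K.val.map a) (Kᶜ.val.map a)
  rw [card_add_compl_map, ← hJ] at hspan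
  simp only [Multiset.card_map, Finset.card_val, Finset.card_univ, Fintype.card_fin] at hspan
  have hsurj : Function.Surjective (map (σ := Fin n) (Polynomial.constantCoeff : _ →+* ℚ)) :=
    map_surjective _ Polynomial.constantCoeff_surjective
  have hle := relationIdeal_map_le (Polynomial.constantCoeff : _ →+* ℚ) n (K.val.map a)
    (Finset.univ.val.map a)
  rw [hrep, hrep, Finset.card_univ, Fintype.card_fin, ← idealI_eq_relationIdeal] at hle
  obtain ⟨p, hp, hpb⟩ := (Ideal.mem_map_iff_of_surjective _ hsurj).1 (hle hb)
  let b' := b.mapRange Polynomial.C Polynomial.C_0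
  -- The lift `p ∈ J` and the constant lift `b'` of the relation agree at `t = 0`, so they differ by
  -- a multiple of `t`.
  obtain ⟨q, hq⟩ : C Polynomial.X ∣ p - b'.sum fun c r => r • monomialAt X c.1 := by
    rw [C_dvd_iff_dvd_coeff]
    intro m
    have hz : map (Polynomial.constantCoeff : _ →+* ℚ)
        (p - b'.sum fun c r => r • monomialAt X c.1) = 0 := by
      rw [map_sub, hpb, Finsupp.sum_mapRange_index (by simp), Finsupp.sum, Finsupp.sum, map_sum,
        sub_eq_zero]
      refine Finset.sum_congr rfl fun c _ => ?_
      rw [smul_eq_C_mul, smul_eq_C_mul, map_mul, map_C, map_monomialAt]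
      simp
    rw [Polynomial.X_dvd_iff, ← Polynomial.constantCoeff_apply, ← coeff_map, hz, coeff_zero]
  obtain ⟨d, hd⟩ := Finsupp.mem_span_range_iff_exists_finsupp.1
    (hspan.ge (Submodule.mem_top (x := Ideal.Quotient.mk J q)))
  have hdJ : q - (d.sum fun c r => r • monomialAt X c.1) ∈ J := by
    rw [← Ideal.Quotient.eq_zero_iff_mem, map_sub, ← hd, sub_eq_zero, Finsupp.sum, Finsupp.sum,
      map_sum]
    refine Finset.sum_congr rfl fun c _ => ?_
    refine ((map_smul (Ideal.Quotient.mkₐ _ J) _ _).trans ?_).symm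
    rw [map_monomialAt]
    rfl
  -- Replacing `q` by its substaircase expansion `d` modulo `J` gives a relation over `ℚ[t]` that
  -- reduces to `b` at `t = 0`.
  have hzero : b' + (Polynomial.X : Polynomial ℚ) • d = 0 := by
    refine eq_zero_of_sum_mem_relationIdeal K ha _ ?_
    have hmem := J.sub_mem hp (J.mul_mem_left (C Polynomial.X) hdJ)
    rw [sum_add_smul_smul, smul_eq_C_mul]
    have heq : p - C Polynomial.X * (q - d.sum fun c r => r • monomialAt X c.1) =
        (b'.sum fun c r => r • monomialAt X c.1) +
          C Polynomial.X * d.sum fun c r => r • monomialAt X c.1 := by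
      linear_combination hq
    exact heq ▸ hmem
  ext c
  have := congrArg Polynomial.constantCoeff (DFunLike.congr_fun hzero c)
  simpa [b'] using this

theorem proposition4p1 (n k s : ℕ) (hks : k ≤ s) :
    LinearIndependent ℚ
      (fun c : {c : Fin n → ℕ // IsSubstaircase n k s c} => monomialClass n k s c.1) ∧
    Submodule.span ℚ
      (Set.range fun c : {c : Fin n → ℕ // IsSubstaircase n k s c} => monomialClass n k s c.1) =
      ⊤ := by
  have hclass (c : Fin n → ℕ) : monomialClass n k s c =
      monomialAt (fun i : Fin n => Ideal.Quotient.mk (idealI n k s) (X i)) c :=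
    map_monomialAt (Ideal.Quotient.mk (idealI n k s)) X c
  simp only [hclass]
  refine ⟨linearIndependent_iff.2 fun b hb => eq_zero_of_sum_mem_idealI hks b ?_,
    substaircaseSpan_idealI_eq_top hks⟩
  rw [← Ideal.Quotient.eq_zero_iff_mem, ← hb, Finsupp.linearCombination_apply, Finsupp.sum,
    Finsupp.sum, map_sum]
  refine Finset.sum_congr rfl fun c _ => ?_
  refine (map_smul (Ideal.Quotient.mkₐ ℚ (idealI n k s)) _ _).trans ?_
  rw [map_monomialAt]
  rfl
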